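/- Let $k$ be a field, let $k[x,y]$ be the polynomial ring in two variables over $k$, and for each positive integer $n$ let $$B_n = k[x,y]\left[\frac{x-1}{x^n y-1}\right]$$ be the subring of the fraction field $k(x,y)$ generated by $k[x,y]$ and the element $(x-1)/(x^n y-1)$, regarded as a $k$-algebra. If $m$ and $n$ are positive integers such that $B_m$ and $B_n$ are isomorphic as $k$-algebras, then $m=n$. -/

import Mathlib

noncomputable section

/-- The coordinate `x` as an element of the field of fractions `k(x, y)` of `k[x, y]`. -/
def xCoord (k : Type*) [Field k] : FractionRing (MvPolynomial (Fin 2) k) :=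
  algebraMap (MvPolynomial (Fin 2) k) _ (MvPolynomial.X 0)

/-- The coordinate `y` as an element of the field of fractions `k(x, y)` of `k[x, y]`. -/
def yCoord (k : Type*) [Field k] : FractionRing (MvPolynomial (Fin 2) k) :=
  algebraMap (MvPolynomial (Fin 2) k) _ (MvPolynomial.X 1)

/-- The ring `B_n = A[(x - 1) / (x ^ n * y - 1)]`, where `A = k[x, y]`: the `A`-subalgebra of
`k(x, y)` generated by `(x - 1) / (x ^ n * y - 1)`, regarded as a `k`-subalgebra. -/
def ringB (k : Type*) [Field k] (n : ℕ) :
    Subalgebra k (FractionRing (MvPolynomial (Fin 2) k)) :=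
  (Algebra.adjoin (MvPolynomial (Fin 2) k)
    {(xCoord k - 1) / (xCoord k ^ n * yCoord k - 1)}).restrictScalars k

end

/-! `B_n` is the coordinate ring of the surface `F = (x ^ n * y - 1) * z - (x - 1) = 0`. With `U = x
^ n * y - 1` it embeds in Laurent polynomials in `X`, `U`, via `y = (U + 1) / X ^ n` and `z = (X -
1) / U`. The Jacobian Poisson bracket of `F` becomes `X ^ (n - 1)` times the logarithmic bracket `X
U ∂_X ∧ ∂_U`.

The partial derivatives of `F` generate the unit ideal, so every alternating biderivation is a
multiple of the Jacobian bracket (`IsAltBiderivation.exists_eq_mul`). An isomorphism `φ : B_m → B_n`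
therefore preserves brackets up to a unit `c`. In `B_m`, `{x, V} = x ^ m * V` for `V = x ^ m * y -
1`. Transporting this by `φ` shows that the logarithmic bracket of `f = φ x` and `g = φ V` is `h * f
* g` with `h = X ^ (-(n - 1)) * c * f ^ (m - 1)`. Comparing extreme exponents forces `h` to be a
constant (`exists_eq_single_zero_of_mul_mul_eq_logBracket`), so `c * φ(x) ^ (m - 1) = r * x ^ (n -
1)` with `r ≠ 0`.

Units have `x`-adic valuation zero, hence `m - 1 ∣ n - 1`. Applying this to `φ.symm` as well gives
`m = n`. The argument is independent of the characteristic. -/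

namespace AddMonoidAlgebra

/-! ### Euler derivations and the logarithmic bracket on a group algebra. -/

section EulerDerivation

variable {k G : Type*} [Field k] [AddCommGroup G]

/-- The `k`-derivation of the group algebra of `G` multiplying the monomial of exponent `g`
by `χ g`, for an additive character `χ` of `G`. -/
noncomputable def eulerDerivation (χ : G →+ k) :
    Derivation k (AddMonoidAlgebra k G) (AddMonoidAlgebra k G) :=
  Derivation.mk'
    { toFun := fun f => ofCoeff (Finsupp.onFinset f.coeff.support (fun g => χ g * f.coeff g)
        (fun g hg => Finsupp.mem_support_iff.2 (right_ne_zero_of_mul hg)))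
      map_add' := fun f g => by ext a; simp [mul_add]
      map_smul' := fun c f => by ext a; simp [mul_left_comm] }
    (fun a b => by
      induction a using induction_linear with
      | zero => simp only [zero_mul, map_zero, zero_smul, smul_zero, add_zero]
      | add a a' h h' => simp only [add_mul, map_add, h, h', smul_eq_mul, mul_add]; ring
      | single g r =>
        induction b using induction_linear with
        | zero => simp only [mul_zero, map_zero, zero_smul, smul_zero, add_zero]
        | add b b' h h' => simp only [add_mul, map_add, h, h', smul_eq_mul, mul_add]; ring
        | single g' r' =>
          have key (g : G) (r : k) : ofCoeff (Finsupp.onFinset (single g r).coeff.support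
              (fun a => χ a * (single g r).coeff a) (fun a ha => Finsupp.mem_support_iff.2
                (right_ne_zero_of_mul ha))) = single g (χ g * r) := by
            classical
            ext a
            by_cases h : g = a <;> simp [Finsupp.single_apply, h]
          simp only [single_mul_single, LinearMap.coe_mk, AddHom.coe_mk, key, smul_eq_mul,
            add_comm g' g, ← single_add, map_add]
          congr 1
          ring)

theorem coeff_eulerDerivation (χ : G →+ k) (f : AddMonoidAlgebra k G) (g : G) :
    (eulerDerivation χ f).coeff g = χ g * f.coeff g :=
  rfl

theorem eulerDerivation_single (χ : G →+ k) (g : G) (r : k) :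
    eulerDerivation χ (single g r) = single g (χ g * r) := by
  classical
  ext a
  by_cases h : g = a <;> simp [coeff_eulerDerivation, h]

theorem support_eulerDerivation_subset (χ : G →+ k) (f : AddMonoidAlgebra k G) :
    (eulerDerivation χ f).coeff.support ⊆ f.coeff.support := fun g hg => by
  rw [Finsupp.mem_support_iff, coeff_eulerDerivation] at hg
  exact Finsupp.mem_support_iff.2 (right_ne_zero_of_mul hg)

/-- The logarithmic Poisson bracket attached to two additive characters. -/
noncomputable def logBracket (χ ψ : G →+ k) (f g : AddMonoidAlgebra k G) :
    AddMonoidAlgebra k G :=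
  eulerDerivation χ f * eulerDerivation ψ g - eulerDerivation ψ f * eulerDerivation χ g

end EulerDerivation

/-! ### Leading exponents and the logarithmic bracket. -/

section Order

theorem exists_isGreatest_support {k G : Type*} [Field k] [AddCommGroup G] [LinearOrder G]
    {f : AddMonoidAlgebra k G} (hf : f ≠ 0) :
    ∃ a, IsGreatest (f.coeff.support : Set G) a := by
  have : f.coeff.support.Nonempty := by
    rw [Finsupp.support_nonempty_iff]
    intro h
    exact hf (by ext a; simp [h])
  exact ⟨_, f.coeff.support.isGreatest_max' this⟩

variable {k G : Type*} [Field k] [AddCommGroup G] [LinearOrder G] [IsOrderedAddMonoid G]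

theorem coeff_mul_add_of_isGreatest {f g : AddMonoidAlgebra k G} {a b : G}
    (ha : IsGreatest (f.coeff.support : Set G) a) (hb : IsGreatest (g.coeff.support : Set G) b) :
    (f * g).coeff (a + b) = f.coeff a * g.coeff b := by
  refine coeff_mul_add_of_uniqueAdd fun a' b' ha' hb' h => ?_
  have h1 : a' ≤ a := ha.2 ha'
  have h2 : b' ≤ b := hb.2 hb'
  rcases h1.lt_or_eq with h1 | rfl
  · exact absurd h (add_lt_add_of_lt_of_le h1 h2).ne
  · exact ⟨rfl, add_left_cancel h⟩

theorem le_add_of_mem_support_mul {f g : AddMonoidAlgebra k G} {a b c : G}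
    (ha : a ∈ upperBounds (f.coeff.support : Set G))
    (hb : b ∈ upperBounds (g.coeff.support : Set G))
    (hc : c ∈ (f * g).coeff.support) : c ≤ a + b := by
  classical
  obtain ⟨a', ha', b', hb', rfl⟩ := Finset.mem_add.1 (support_coeff_mul_subset f g hc)
  exact add_le_add (ha ha') (hb hb')

/-- Euler derivations rescale monomials, so the bracket has no exponent above the sum of the leading
exponents of `f` and `g`, while leading exponents add exactly in `h * (f * g)`. Only an inclusion of
supports is used, so characters vanishing modulo the characteristic do no harm. -/
theorem le_zero_of_mul_mul_eq_logBracket (χ ψ : G →+ k) {f g h : AddMonoidAlgebra k G}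
    (hf : f ≠ 0) (hg : g ≠ 0) (H : h * (f * g) = logBracket χ ψ f g) {c : G}
    (hc : c ∈ h.coeff.support) : c ≤ 0 := by
  have hh : h ≠ 0 := by
    rintro rfl
    simp at hc
  obtain ⟨a, ha⟩ := exists_isGreatest_support hf
  obtain ⟨b, hb⟩ := exists_isGreatest_support hg
  obtain ⟨e, he⟩ := exists_isGreatest_support hh
  have hprod : a + b ∈ upperBounds ((f * g).coeff.support : Set G) :=
    fun c hc => le_add_of_mem_support_mul ha.2 hb.2 hc
  have hab : IsGreatest ((f * g).coeff.support : Set G) (a + b) := by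
    refine ⟨Finsupp.mem_support_iff.2 ?_, hprod⟩
    rw [coeff_mul_add_of_isGreatest ha hb]
    exact mul_ne_zero (Finsupp.mem_support_iff.1 ha.1) (Finsupp.mem_support_iff.1 hb.1)
  have hne : (logBracket χ ψ f g).coeff (e + (a + b)) ≠ 0 := by
    rw [← H, coeff_mul_add_of_isGreatest he hab]
    exact mul_ne_zero (Finsupp.mem_support_iff.1 he.1) (Finsupp.mem_support_iff.1 hab.1)
  have bound (χ ψ : G →+ k)
      (h : (eulerDerivation χ f * eulerDerivation ψ g).coeff (e + (a + b)) ≠ 0) : e ≤ 0 := by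
    have := le_add_of_mem_support_mul
      (fun x hx => ha.2 (support_eulerDerivation_subset χ f hx))
      (fun x hx => hb.2 (support_eulerDerivation_subset ψ g hx)) (Finsupp.mem_support_iff.2 h)
    simpa using this
  refine (he.2 hc).trans ?_
  by_cases h1 : (eulerDerivation χ f * eulerDerivation ψ g).coeff (e + (a + b)) = 0
  · refine bound ψ χ fun h2 => hne ?_
    simp [logBracket, h1, h2]
  · exact bound χ ψ h1

theorem exists_eq_single_zero_of_mul_mul_eq_logBracket (χ ψ : G →+ k)
    {f g h : AddMonoidAlgebra k G} (hf : f ≠ 0) (hg : g ≠ 0)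
    (H : h * (f * g) = logBracket χ ψ f g) : ∃ r : k, h = single 0 r := by
  have key : ∀ c ∈ h.coeff.support, c = 0 := fun c hc =>
    le_antisymm (le_zero_of_mul_mul_eq_logBracket χ ψ hf hg H hc)
      -- The same bound for the reversed order on `G` gives `0 ≤ c`.
      (@le_zero_of_mul_mul_eq_logBracket k G _ _ (OrderDual.instLinearOrder G)
        OrderDual.isOrderedAddMonoid χ ψ f g h hf hg H c hc)
  classical
  refine ⟨h.coeff 0, ?_⟩
  ext c
  by_cases hc : c = 0
  · simp [hc]
  · have : h.coeff c = 0 := by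
      by_contra h0
      exact hc (key c (Finsupp.mem_support_iff.2 h0))
    simp [this, Ne.symm hc]

end Order

end AddMonoidAlgebra

/-! ### Alternating biderivations and the Jacobian bracket on a smooth surface. -/

/-- `E` is an alternating `k`-biderivation of `R` with values in `S`, viewed as an `R`-algebra
through `φ`. -/
structure IsAltBiderivation {k R S : Type*} [CommRing k] [CommRing R] [CommRing S] [Algebra k R]
    [Algebra k S] (φ : R →ₐ[k] S) (E : R → R → S) : Prop where
  self : ∀ a, E a a = 0
  swap : ∀ a b, E b a = -E a b
  add_left : ∀ a b c, E (a + b) c = E a c + E b c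
  mul_left : ∀ a b c, E (a * b) c = φ a * E b c + φ b * E a c
  algebraMap_left : ∀ r c, E (algebraMap k R r) c = 0

namespace IsAltBiderivation

variable {k R S T : Type*} [CommRing k] [CommRing R] [CommRing S] [CommRing T] [Algebra k R]
  [Algebra k S] [Algebra k T] {φ : R →ₐ[k] S} {E E' : R → R → S}

theorem one_left (h : IsAltBiderivation φ E) (c : R) : E 1 c = 0 := by
  simpa using h.algebraMap_left 1 c

theorem sub_left (h : IsAltBiderivation φ E) (a b c : R) : E (a - b) c = E a c - E b c := by
  have := h.add_left (a - b) b c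
  rw [sub_add_cancel] at this
  rw [this, add_sub_cancel_right]

theorem mul_right (h : IsAltBiderivation φ E) (a b c : R) :
    E c (a * b) = φ a * E c b + φ b * E c a := by
  rw [h.swap (a * b) c, h.mul_left, h.swap c a, h.swap c b]
  ring

theorem sub_right (h : IsAltBiderivation φ E) (a b c : R) : E c (a - b) = E c a - E c b := by
  rw [h.swap (a - b) c, h.sub_left, h.swap c a, h.swap c b]
  ring

theorem one_right (h : IsAltBiderivation φ E) (c : R) : E c 1 = 0 := by
  rw [h.swap, h.one_left, neg_zero]

theorem pow_left (h : IsAltBiderivation φ E) (a c : R) (n : ℕ) :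
    E (a ^ n) c = n * φ a ^ (n - 1) * E a c := by
  induction n with
  | zero => simpa using h.one_left c
  | succ n ih =>
    rw [pow_succ, h.mul_left, ih]
    cases n with
    | zero => simp
    | succ n =>
      simp only [map_pow, Nat.add_sub_cancel]
      push_cast
      ring

theorem pow_right (h : IsAltBiderivation φ E) (a c : R) (n : ℕ) :
    E c (a ^ n) = n * φ a ^ (n - 1) * E c a := by
  rw [h.swap (a ^ n) c, h.pow_left, h.swap c a]
  ring

theorem eq_zero_of_adjoin (h : IsAltBiderivation φ E) {s : Set R} (hs : Algebra.adjoin k s = ⊤)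
    (h0 : ∀ a ∈ s, ∀ b ∈ s, E a b = 0) (a b : R) : E a b = 0 := by
  have left (c : R) (hc : ∀ a ∈ s, E a c = 0) (a : R) : E a c = 0 := by
    have ha : a ∈ Algebra.adjoin k s := hs ▸ Algebra.mem_top
    induction ha using Algebra.adjoin_induction with
    | mem a ha => exact hc a ha
    | algebraMap r => exact h.algebraMap_left r c
    | add a b _ _ iha ihb => rw [h.add_left, iha, ihb, add_zero]
    | mul a b _ _ iha ihb => rw [h.mul_left, iha, ihb, mul_zero, mul_zero, add_zero]
  refine left b (fun a ha => ?_) a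
  rw [h.swap, left a (fun b hb => h0 b hb a ha), neg_zero]

theorem mem_adjoin {B : S → S → S} (h : IsAltBiderivation (AlgHom.id k S) B) {s : Set S}
    (h0 : ∀ a ∈ s, ∀ b ∈ s, B a b ∈ Algebra.adjoin k s) {a b : S} (ha : a ∈ Algebra.adjoin k s)
    (hb : b ∈ Algebra.adjoin k s) : B a b ∈ Algebra.adjoin k s := by
  have left (c : S) (hc : c ∈ Algebra.adjoin k s) (h1 : ∀ a ∈ s, B a c ∈ Algebra.adjoin k s)
      (a : S) (ha : a ∈ Algebra.adjoin k s) : B a c ∈ Algebra.adjoin k s := by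
    induction ha using Algebra.adjoin_induction with
    | mem a ha => exact h1 a ha
    | algebraMap r => rw [h.algebraMap_left]; exact zero_mem _
    | add a b _ _ iha ihb => rw [h.add_left]; exact add_mem iha ihb
    | mul a b ha hb iha ihb =>
      rw [h.mul_left]; exact add_mem (mul_mem ha ihb) (mul_mem hb iha)
  refine left b hb (fun a ha => ?_) a ha
  rw [h.swap]
  exact neg_mem (left a (Algebra.subset_adjoin ha) (fun b hb => h0 b hb a ha) b hb)

theorem mem_adjoin_triple {B : S → S → S} (h : IsAltBiderivation (AlgHom.id k S) B) {x y z : S}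
    (hxy : B x y ∈ Algebra.adjoin k {x, y, z}) (hyz : B y z ∈ Algebra.adjoin k {x, y, z})
    (hzx : B z x ∈ Algebra.adjoin k {x, y, z}) {a b : S} (ha : a ∈ Algebra.adjoin k {x, y, z})
    (hb : b ∈ Algebra.adjoin k {x, y, z}) : B a b ∈ Algebra.adjoin k {x, y, z} := by
  have hyx := neg_mem hxy
  have hzy := neg_mem hyz
  have hxz := neg_mem hzx
  rw [← h.swap] at hyx hzy hxz
  have hself (a : S) : B a a ∈ Algebra.adjoin k {x, y, z} := by rw [h.self]; exact zero_mem _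
  refine h.mem_adjoin ?_ ha hb
  rintro a (rfl | rfl | rfl) b (rfl | rfl | rfl) <;> first | assumption | exact hself _

theorem sub_smul (h : IsAltBiderivation φ E) (h' : IsAltBiderivation φ E') (c : S) :
    IsAltBiderivation φ fun a b => E a b - c * E' a b where
  self a := by rw [h.self, h'.self]; ring
  swap a b := by rw [h.swap, h'.swap]; ring
  add_left a b d := by rw [h.add_left, h'.add_left]; ring
  mul_left a b d := by rw [h.mul_left, h'.mul_left]; ring
  algebraMap_left r d := by rw [h.algebraMap_left, h'.algebraMap_left]; ring

theorem comp {B : S → S → T} {ψ : S →ₐ[k] T} (h : IsAltBiderivation ψ B) (φ : R →ₐ[k] S) :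
    IsAltBiderivation (ψ.comp φ) fun a b => B (φ a) (φ b) where
  self a := h.self _
  swap a b := h.swap _ _
  add_left a b c := by rw [map_add, h.add_left]
  mul_left a b c := by rw [map_mul, h.mul_left]; rfl
  algebraMap_left r c := by rw [AlgHom.commutes, h.algebraMap_left]

theorem map (h : IsAltBiderivation φ E) (ψ : S →ₐ[k] T) :
    IsAltBiderivation (ψ.comp φ) fun a b => ψ (E a b) where
  self a := by rw [h.self, map_zero]
  swap a b := by rw [h.swap, map_neg]
  add_left a b c := by rw [h.add_left, map_add]
  mul_left a b c := by rw [h.mul_left, map_add, map_mul, map_mul]; rfl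
  algebraMap_left r c := by rw [h.algebraMap_left, map_zero]

/-- On the smooth surface `(x ^ n * y - 1) * z = x - 1`, every alternating biderivation is a
multiple of the Jacobian one. -/
theorem exists_eq_mul {Q : R → R → S} (hE : IsAltBiderivation φ E) (hQ : IsAltBiderivation φ Q)
    {x y z : R} (hs : Algebra.adjoin k {x, y, z} = ⊤) {n : ℕ} (hn : 0 < n)
    (rel : (x ^ n * y - 1) * z = x - 1)
    (hxy : Q x y = φ (x ^ n * y - 1)) (hyz : Q y z = φ (n * x ^ (n - 1) * y * z - 1))
    (hzx : Q z x = φ (x ^ n * z)) :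
    ∃ c : S, ∀ a b, E a b = c * Q a b := by
  obtain ⟨n, rfl⟩ : ∃ l, n = l + 1 := ⟨n - 1, by omega⟩
  simp only [Nat.add_sub_cancel] at hyz
  set Fx : R := (n + 1 : ℕ) * x ^ n * y * z - 1
  set Fy : R := x ^ (n + 1) * z
  set Fz : R := x ^ (n + 1) * y - 1
  have hF (a : R) : φ Fx * E a x + φ Fy * E a y + φ Fz * E a z = 0 := by
    -- Differentiating the relation: `Fx`, `Fy`, `Fz` are the partial derivatives of `(x ^ n * y -
    -- 1) * z - x + 1`.
    have h1 := congrArg (E a) rel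
    rw [hE.mul_right, hE.sub_right, hE.sub_right, hE.mul_right, hE.pow_right, hE.one_right] at h1
    simp only [Fx, Fy, Fz, map_sub, map_mul, map_pow, map_natCast, map_one,
      Nat.add_sub_cancel] at h1 ⊢
    linear_combination h1
  have hx := hF x
  have hy := hF y
  have hz := hF z
  rw [hE.self, hE.swap z x] at hx
  rw [hE.self, hE.swap x y] at hy
  rw [hE.self, hE.swap y z] at hz
  -- Smoothness made explicit: a Bézout identity for the partial derivatives.
  have one : -(φ x ^ (n + 1) * φ y) * φ Fx + ((n + 1 : ℕ) * φ x ^ n * φ y ^ 2) * φ Fy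
      - φ Fz = 1 := by
    simp only [Fx, Fy, Fz, map_sub, map_mul, map_pow, map_natCast, map_one]
    ring
  set A : S := -(φ x ^ (n + 1) * φ y)
  set B : S := (n + 1 : ℕ) * φ x ^ n * φ y ^ 2
  -- Since `Q` takes the values `Fx`, `Fy`, `Fz` on `(y, z)`, `(z, x)`, `(x, y)`, the Bézout
  -- identity forces this multiplier.
  refine ⟨A * E y z + B * E z x - E x y, fun a b => ?_⟩
  set c := A * E y z + B * E z x - E x y with hc
  have exy : E x y = c * Q x y := by
    rw [hxy, hc]
    linear_combination (-E x y) * one - A * hy + B * hx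
  have eyz : E y z = c * Q y z := by
    rw [hyz, hc]
    linear_combination (-E y z) * one - B * hz - hy
  have ezx : E z x = c * Q z x := by
    rw [hzx, hc]
    linear_combination (-E z x) * one + A * hz + hx
  refine sub_eq_zero.1 ((hE.sub_smul hQ c).eq_zero_of_adjoin hs ?_ a b)
  have key : E y x = c * Q y x ∧ E z y = c * Q z y ∧ E x z = c * Q x z := by
    rw [hE.swap x y, hE.swap y z, hE.swap z x, hQ.swap x y, hQ.swap y z, hQ.swap z x, exy, eyz,
      ezx]
    refine ⟨?_, ?_, ?_⟩ <;> ring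
  rintro a (rfl | rfl | rfl) b (rfl | rfl | rfl) <;>
    simp [hE.self, hQ.self, exy, eyz, ezx, key]

end IsAltBiderivation

/-! ### The surface and its bracket in Laurent coordinates. -/

namespace LaurentSurface

open AddMonoidAlgebra

variable (k : Type*) [Field k]

/-- The ring of Laurent polynomials in two variables `X`, `U`, with lexicographically ordered
exponents. -/
abbrev Laurent := AddMonoidAlgebra k (ℤ ×ₗ ℤ)

/-- The first variable. -/
noncomputable def X : Laurent k := single (toLex (1, 0)) 1

/-- The inverse of the first variable. -/
noncomputable def Xinv : Laurent k := single (toLex (-1, 0)) 1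

/-- The second variable. -/
noncomputable def U : Laurent k := single (toLex (0, 1)) 1

/-- The inverse of the second variable. -/
noncomputable def Uinv : Laurent k := single (toLex (0, -1)) 1

/-- The element `(U + 1) / X ^ n`. -/
noncomputable def Y (n : ℕ) : Laurent k := (U k + 1) * Xinv k ^ n

/-- The element `(X - 1) / U`. -/
noncomputable def Z : Laurent k := (X k - 1) * Uinv k

theorem X_mul_Xinv : X k * Xinv k = 1 := by
  rw [X, Xinv, single_mul_single, mul_one]; rfl

theorem U_mul_Uinv : U k * Uinv k = 1 := by
  rw [U, Uinv, single_mul_single, mul_one]; rfl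

theorem X_ne_zero : X k ≠ 0 := left_ne_zero_of_mul_eq_one (X_mul_Xinv k)

theorem U_ne_zero : U k ≠ 0 := left_ne_zero_of_mul_eq_one (U_mul_Uinv k)

theorem X_pow_mul_Xinv_pow (n : ℕ) : X k ^ n * Xinv k ^ n = 1 := by
  rw [← mul_pow, X_mul_Xinv, one_pow]

theorem X_pow_mul_Y (n : ℕ) : X k ^ n * Y k n = U k + 1 := by
  rw [Y, mul_left_comm, X_pow_mul_Xinv_pow, mul_one]

theorem U_mul_Z : U k * Z k = X k - 1 := by
  rw [Z, mul_left_comm, U_mul_Uinv, mul_one]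

/-- The exponent of `X`, with values in `k`. -/
def xExp : (ℤ ×ₗ ℤ) →+ k where
  toFun g := ((ofLex g).1 : k)
  map_zero' := by simp
  map_add' a b := by simp

/-- The exponent of `U`, with values in `k`. -/
def uExp : (ℤ ×ₗ ℤ) →+ k where
  toFun g := ((ofLex g).2 : k)
  map_zero' := by simp
  map_add' a b := by simp

theorem xDer_X : eulerDerivation (xExp k) (X k) = X k := by
  rw [X, eulerDerivation_single]; simp [xExp]

theorem uDer_X : eulerDerivation (uExp k) (X k) = 0 := by
  rw [X, eulerDerivation_single]; simp [uExp]

theorem uDer_U : eulerDerivation (uExp k) (U k) = U k := by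
  rw [U, eulerDerivation_single]; simp [uExp]

/-- The Poisson bracket `X ^ (n - 1) * (X U ∂_X ∧ ∂_U)`. -/
noncomputable def bracket (n : ℕ) (f g : Laurent k) : Laurent k :=
  X k ^ (n - 1) * logBracket (xExp k) (uExp k) f g

theorem isAltBiderivation_bracket (n : ℕ) :
    IsAltBiderivation (AlgHom.id k (Laurent k)) (bracket k n) where
  self a := by rw [bracket, logBracket]; ring
  swap a b := by simp only [bracket, logBracket]; ring
  add_left a b c := by simp only [bracket, logBracket, map_add]; ring
  mul_left a b c := by
    simp only [bracket, logBracket, Derivation.leibniz, smul_eq_mul, AlgHom.id_apply]; ring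
  algebraMap_left r c := by
    simp only [bracket, logBracket, Derivation.map_algebraMap]; ring

variable {k}

theorem bracket_X_U {n : ℕ} (hn : 0 < n) : bracket k n (X k) (U k) = X k ^ n * U k := by
  obtain ⟨n, rfl⟩ : ∃ l, n = l + 1 := ⟨n - 1, by omega⟩
  rw [bracket, logBracket, xDer_X, uDer_X, uDer_U, Nat.add_sub_cancel]
  ring

theorem bracket_X_Y {n : ℕ} (hn : 0 < n) : bracket k n (X k) (Y k n) = U k := by
  have h := isAltBiderivation_bracket k n
  have h1 := congrArg (bracket k n (X k)) (X_pow_mul_Y k n)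
  rw [h.mul_right, h.pow_right, h.self, h.swap (U k + 1), h.add_left, h.one_left, add_zero,
    ← h.swap, bracket_X_U hn] at h1
  simp only [map_pow, AlgHom.id_apply, mul_zero, add_zero] at h1
  exact mul_left_cancel₀ (pow_ne_zero n (X_ne_zero k)) h1

theorem bracket_Z_X {n : ℕ} (hn : 0 < n) : bracket k n (Z k) (X k) = X k ^ n * Z k := by
  have h := isAltBiderivation_bracket k n
  have h1 := congrArg (bracket k n (X k)) (U_mul_Z k)
  rw [h.mul_right, h.sub_right, h.one_right, h.self, bracket_X_U hn, h.swap (Z k)] at h1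
  simp only [AlgHom.id_apply] at h1
  refine mul_left_cancel₀ (U_ne_zero k) ?_
  linear_combination -h1

theorem bracket_Y_Z {n : ℕ} (hn : 0 < n) :
    bracket k n (Y k n) (Z k) = n * X k ^ (n - 1) * Y k n * Z k - 1 := by
  have h := isAltBiderivation_bracket k n
  have h1 := congrArg (bracket k n (Z k)) (X_pow_mul_Y k n)
  have h2 : bracket k n (Z k) (U k + 1) = bracket k n (Z k) (U k) := by
    rw [h.swap, h.add_left, h.one_left, add_zero, ← h.swap]
  have h3 := congrArg (bracket k n (U k)) (U_mul_Z k)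
  rw [h.mul_right, h.sub_right, h.one_right, h.self, h.swap (X k), bracket_X_U hn,
    h.swap (Z k)] at h3
  rw [h2, h.mul_right, h.pow_right, bracket_Z_X hn, h.swap (Y k n) (Z k)] at h1
  simp only [AlgHom.id_apply, map_pow] at h1 h3
  refine mul_left_cancel₀ (pow_ne_zero n (X_ne_zero k)) (mul_left_cancel₀ (U_ne_zero k) ?_)
  linear_combination -U k * h1 + h3

variable (k) in
/-- The `k`-algebra generated by `X`, `Y` and `Z`. -/
noncomputable def surface (n : ℕ) : Subalgebra k (Laurent k) :=
  Algebra.adjoin k {X k, Y k n, Z k}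

theorem X_mem_surface (n : ℕ) : X k ∈ surface k n := Algebra.subset_adjoin (by simp)
theorem Y_mem_surface (n : ℕ) : Y k n ∈ surface k n := Algebra.subset_adjoin (by simp)
theorem Z_mem_surface (n : ℕ) : Z k ∈ surface k n := Algebra.subset_adjoin (by simp)

theorem U_mem_surface (n : ℕ) : U k ∈ surface k n := by
  have : U k = X k ^ n * Y k n - 1 := by rw [X_pow_mul_Y, add_sub_cancel_right]
  rw [this]
  exact sub_mem (mul_mem (pow_mem (X_mem_surface n) n) (Y_mem_surface n)) (one_mem _)

/-- The factor `X ^ (n - 1)` makes the brackets of the generators the partial derivatives of the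
equation, which are polynomials in the generators. -/
theorem bracket_mem_surface {n : ℕ} (hn : 0 < n) {f g : Laurent k} (hf : f ∈ surface k n)
    (hg : g ∈ surface k n) : bracket k n f g ∈ surface k n := by
  have h := isAltBiderivation_bracket k n
  have hX := X_mem_surface (k := k) n
  have hY := Y_mem_surface (k := k) n
  have hZ := Z_mem_surface (k := k) n
  have hxy : bracket k n (X k) (Y k n) ∈ surface k n := by
    rw [bracket_X_Y hn]; exact U_mem_surface n
  have hyz : bracket k n (Y k n) (Z k) ∈ surface k n := by
    rw [bracket_Y_Z hn]
    exact sub_mem (mul_mem (mul_mem (mul_mem (natCast_mem _ n) (pow_mem hX _)) hY) hZ)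
      (one_mem _)
  have hzx : bracket k n (Z k) (X k) ∈ surface k n := by
    rw [bracket_Z_X hn]; exact mul_mem (pow_mem hX _) hZ
  exact h.mem_adjoin_triple hxy hyz hzx hf hg

end LaurentSurface

/-! ### Isomorphisms and the Poisson bracket. -/

namespace LaurentSurface

open AddMonoidAlgebra

variable {k : Type*} [Field k]

/-- The Poisson bracket of `surface k n`. -/
noncomputable def surfaceBracket {n : ℕ} (hn : 0 < n) (f g : surface k n) : surface k n :=
  ⟨bracket k n f g, bracket_mem_surface hn f.2 g.2⟩

theorem isAltBiderivation_surfaceBracket {n : ℕ} (hn : 0 < n) :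
    IsAltBiderivation (AlgHom.id k (surface k n)) (surfaceBracket hn) where
  self a := Subtype.ext ((isAltBiderivation_bracket k n).self a)
  swap a b := Subtype.ext ((isAltBiderivation_bracket k n).swap a b)
  add_left a b c := Subtype.ext ((isAltBiderivation_bracket k n).add_left a b c)
  mul_left a b c := Subtype.ext ((isAltBiderivation_bracket k n).mul_left a b c)
  algebraMap_left r c := Subtype.ext ((isAltBiderivation_bracket k n).algebraMap_left r c)

/-- `X` as an element of `surface k n`. -/
noncomputable def xS (k : Type*) [Field k] (n : ℕ) : surface k n := ⟨X k, X_mem_surface n⟩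

/-- `Y` as an element of `surface k n`. -/
noncomputable def yS (k : Type*) [Field k] (n : ℕ) : surface k n := ⟨Y k n, Y_mem_surface n⟩

/-- `Z` as an element of `surface k n`. -/
noncomputable def zS (k : Type*) [Field k] (n : ℕ) : surface k n := ⟨Z k, Z_mem_surface n⟩

theorem adjoin_xS_yS_zS (n : ℕ) : Algebra.adjoin k {xS k n, yS k n, zS k n} = ⊤ := by
  have h := Algebra.adjoin_adjoin_coe_preimage (R := k) (s := {X k, Y k n, Z k})
  have hs : ({xS k n, yS k n, zS k n} : Set (surface k n)) =
      (Subtype.val : surface k n → Laurent k) ⁻¹' {X k, Y k n, Z k} := by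
    ext a
    simp only [Set.mem_insert_iff, Set.mem_singleton_iff, Set.mem_preimage, Subtype.ext_iff]
    rfl
  rw [hs]
  exact h

theorem surfaceBracket_xS_yS {n : ℕ} (hn : 0 < n) :
    surfaceBracket hn (xS k n) (yS k n) = xS k n ^ n * yS k n - 1 := by
  refine Subtype.ext ?_
  change bracket k n (X k) (Y k n) = X k ^ n * Y k n - 1
  rw [bracket_X_Y hn, X_pow_mul_Y, add_sub_cancel_right]

theorem surfaceBracket_yS_zS {n : ℕ} (hn : 0 < n) :
    surfaceBracket hn (yS k n) (zS k n) = n * xS k n ^ (n - 1) * yS k n * zS k n - 1 :=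
  Subtype.ext (bracket_Y_Z hn)

theorem surfaceBracket_zS_xS {n : ℕ} (hn : 0 < n) :
    surfaceBracket hn (zS k n) (xS k n) = xS k n ^ n * zS k n :=
  Subtype.ext (bracket_Z_X hn)

theorem surface_relation (n : ℕ) : (xS k n ^ n * yS k n - 1) * zS k n = xS k n - 1 := by
  refine Subtype.ext ?_
  change (X k ^ n * Y k n - 1) * Z k = X k - 1
  rw [X_pow_mul_Y, add_sub_cancel_right, U_mul_Z]

theorem xS_pow_mul_yS_sub_one_ne_zero (n : ℕ) : xS k n ^ n * yS k n - 1 ≠ 0 := by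
  intro h
  have : X k ^ n * Y k n - 1 = 0 := congrArg Subtype.val h
  rw [X_pow_mul_Y, add_sub_cancel_right] at this
  exact U_ne_zero k this

/-- Both sides are alternating biderivations along `φ`, and the one transported from the source is
Jacobian. -/
theorem exists_surfaceBracket_map_eq {m n : ℕ} (hm : 0 < m) (hn : 0 < n)
    (φ : surface k m →ₐ[k] surface k n) :
    ∃ c, ∀ a b, surfaceBracket hn (φ a) (φ b) = c * φ (surfaceBracket hm a b) := by
  have hE := (isAltBiderivation_surfaceBracket hn).comp φ
  have hQ := (isAltBiderivation_surfaceBracket hm).map φ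
  rw [AlgHom.id_comp] at hE
  rw [AlgHom.comp_id] at hQ
  exact hE.exists_eq_mul hQ (adjoin_xS_yS_zS m) hm (surface_relation m)
    (congrArg φ (surfaceBracket_xS_yS hm)) (congrArg φ (surfaceBracket_yS_zS hm))
    (congrArg φ (surfaceBracket_zS_xS hm))

/-- Isomorphisms preserve the Poisson brackets up to a unit. -/
theorem exists_isUnit_surfaceBracket_map_eq {m n : ℕ} (hm : 0 < m) (hn : 0 < n)
    (φ : surface k m ≃ₐ[k] surface k n) :
    ∃ c, IsUnit c ∧ ∀ a b, surfaceBracket hn (φ a) (φ b) = c * φ (surfaceBracket hm a b) := by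
  obtain ⟨c, hc⟩ := exists_surfaceBracket_map_eq hm hn φ.toAlgHom
  obtain ⟨d, hd⟩ := exists_surfaceBracket_map_eq hn hm φ.symm.toAlgHom
  refine ⟨c, IsUnit.of_mul_eq_one (φ d) ?_, hc⟩
  -- Composing the comparisons for `φ` and `φ.symm` on the pair `(x, y)` gives `c * φ d = 1` after
  -- cancelling the nonzero bracket `{x, y}`.
  have h := hc (φ.symm (xS k n)) (φ.symm (yS k n))
  have h' := hd (xS k n) (yS k n)
  change surfaceBracket hn (φ (φ.symm (xS k n))) (φ (φ.symm (yS k n))) = c * φ _ at h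
  change surfaceBracket hm (φ.symm (xS k n)) (φ.symm (yS k n)) = d * φ.symm _ at h'
  rw [AlgEquiv.apply_symm_apply, AlgEquiv.apply_symm_apply, h', map_mul, AlgEquiv.apply_symm_apply, surfaceBracket_xS_yS hn] at h
  refine mul_right_cancel₀ (xS_pow_mul_yS_sub_one_ne_zero n) ?_
  rw [one_mul, mul_assoc, ← h]

/-- The identity `{x, V} = x ^ m * V`, moved through the isomorphism, becomes an equation for a
logarithmic bracket whose cofactor must be constant. -/
theorem exists_isUnit_mul_map_xS_pow {m n : ℕ} (hm : 0 < m) (hn : 0 < n)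
    (φ : surface k m ≃ₐ[k] surface k n) :
    ∃ c, IsUnit c ∧ ∃ r : k, r ≠ 0 ∧
      c * φ (xS k m) ^ (m - 1) = algebraMap k _ r * xS k n ^ (n - 1) := by
  obtain ⟨c, hcu, hc⟩ := exists_isUnit_surfaceBracket_map_eq hm hn φ
  refine ⟨c, hcu, ?_⟩
  set V : surface k n := φ (xS k m ^ m * yS k m - 1) with hV
  have hV0 : V ≠ 0 := by
    rw [hV, Ne, map_eq_zero_iff φ φ.injective]
    exact xS_pow_mul_yS_sub_one_ne_zero m
  have hX0 : xS k m ≠ 0 := fun h => X_ne_zero k (congrArg Subtype.val h)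
  have hφ0 : φ (xS k m) ≠ 0 := by
    rw [Ne, map_eq_zero_iff φ φ.injective]; exact hX0
  have hbr : surfaceBracket hn (φ (xS k m)) V = c * (φ (xS k m) ^ m * V) := by
    have h := isAltBiderivation_surfaceBracket (k := k) hm
    rw [hV, hc, h.sub_right, h.mul_right, h.pow_right, h.self, h.one_right,
      surfaceBracket_xS_yS hm]
    simp
  have hbr' : X k ^ (n - 1) * logBracket (xExp k) (uExp k) (φ (xS k m)) V =
      c * ((φ (xS k m) : Laurent k) ^ m * V) := congrArg Subtype.val hbr
  have hm1 : (φ (xS k m) : Laurent k) ^ m = (φ (xS k m) : Laurent k) ^ (m - 1) * φ (xS k m) := by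
    rw [← pow_succ, Nat.sub_add_cancel hm]
  obtain ⟨r, hr⟩ := exists_eq_single_zero_of_mul_mul_eq_logBracket (xExp k) (uExp k)
    (f := (φ (xS k m) : Laurent k)) (g := (V : Laurent k))
    (h := Xinv k ^ (n - 1) * (c * (φ (xS k m) : Laurent k) ^ (m - 1)))
    (fun h => hφ0 (Subtype.ext h)) (fun h => hV0 (Subtype.ext h))
    (by
      refine mul_left_cancel₀ (pow_ne_zero (n - 1) (X_ne_zero k)) ?_
      rw [hbr', hm1]
      linear_combination (c * (φ (xS k m) : Laurent k) ^ (m - 1) * φ (xS k m) * V) *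
        X_pow_mul_Xinv_pow k (n - 1))
  have hfin : c * φ (xS k m) ^ (m - 1) = algebraMap k _ r * xS k n ^ (n - 1) := by
    refine Subtype.ext ?_
    change (c : Laurent k) * (φ (xS k m) : Laurent k) ^ (m - 1) = single 0 r * X k ^ (n - 1)
    rw [← hr]
    linear_combination -(c * (φ (xS k m) : Laurent k) ^ (m - 1)) * X_pow_mul_Xinv_pow k (n - 1)
  refine ⟨r, ?_, hfin⟩
  rintro rfl
  rw [map_zero, zero_mul] at hfin
  exact mul_ne_zero hcu.ne_zero (pow_ne_zero _ hφ0) hfin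

end LaurentSurface

/-! ### Comparison of `ringB` with the Laurent model, and `x`-adic valuation. -/

namespace LaurentSurface

open AddMonoidAlgebra

variable (k : Type*) [Field k]

theorem xCoord_pow_mul_yCoord_sub_one_ne_zero {n : ℕ} (hn : 0 < n) :
    xCoord k ^ n * yCoord k - 1 ≠ 0 := by
  intro h
  have h1 : algebraMap (MvPolynomial (Fin 2) k) (FractionRing (MvPolynomial (Fin 2) k))
      (MvPolynomial.X 0 ^ n * MvPolynomial.X 1 - 1) = 0 := by
    simpa [xCoord, yCoord] using h
  rw [map_eq_zero_iff _ (IsFractionRing.injective _ _)] at h1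
  have h2 := congrArg (MvPolynomial.eval (fun _ => (0 : k))) h1
  simp [hn.ne'] at h2

theorem xCoord_ne_zero : xCoord k ≠ 0 := by
  rw [xCoord, Ne, map_eq_zero_iff _ (IsFractionRing.injective _ _)]
  exact MvPolynomial.X_ne_zero 0

/-- The substitution `U = x ^ n * y - 1` from Laurent polynomials to rational functions. -/
noncomputable def toRatFunc {n : ℕ} (hn : 0 < n) :
    Laurent k →ₐ[k] FractionRing (MvPolynomial (Fin 2) k) :=
  AddMonoidAlgebra.lift k _ _
    { toFun := fun g => xCoord k ^ (ofLex g.toAdd).1 *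
        (xCoord k ^ n * yCoord k - 1) ^ (ofLex g.toAdd).2
      map_one' := by simp
      map_mul' := fun g h => by
        simp only [toAdd_mul, ofLex_add, Prod.fst_add, Prod.snd_add,
          zpow_add₀ (xCoord_ne_zero k), zpow_add₀ (xCoord_pow_mul_yCoord_sub_one_ne_zero k hn)]
        ring }

/-- The substitution `x = X`, `y = (U + 1) / X ^ n`. -/
noncomputable def ofPoly (n : ℕ) : MvPolynomial (Fin 2) k →ₐ[k] Laurent k :=
  MvPolynomial.aeval ![X k, Y k n]

theorem ofPoly_X_zero (n : ℕ) : ofPoly k n (MvPolynomial.X 0) = X k := by simp [ofPoly]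

theorem ofPoly_X_one (n : ℕ) : ofPoly k n (MvPolynomial.X 1) = Y k n := by simp [ofPoly]

theorem toRatFunc_ofPoly {n : ℕ} (hn : 0 < n) (p : MvPolynomial (Fin 2) k) :
    toRatFunc k hn (ofPoly k n p) = algebraMap _ _ p := by
  have hX : toRatFunc k hn (X k) = xCoord k := by simp [toRatFunc, X]
  have hXinv : toRatFunc k hn (Xinv k) = (xCoord k)⁻¹ := by simp [toRatFunc, Xinv]
  have hU : toRatFunc k hn (U k) = xCoord k ^ n * yCoord k - 1 := by simp [toRatFunc, U]
  have hY : toRatFunc k hn (Y k n) = yCoord k := by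
    have := pow_ne_zero n (xCoord_ne_zero k)
    rw [Y, map_mul, map_add, map_pow, hXinv, hU, map_one]
    rw [sub_add_cancel, inv_pow, mul_right_comm, mul_inv_cancel₀ this, one_mul]
  have : (toRatFunc k hn).comp (ofPoly k n) = IsScalarTower.toAlgHom k _ _ := by
    refine MvPolynomial.algHom_ext fun i => ?_
    fin_cases i
    · exact (congrArg _ (ofPoly_X_zero k n)).trans hX
    · exact (congrArg _ (ofPoly_X_one k n)).trans hY
  exact DFunLike.congr_fun this p

theorem ofPoly_injective {n : ℕ} (hn : 0 < n) : Function.Injective (ofPoly k n) := by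
  intro p q h
  have := congrArg (toRatFunc k hn) h
  rw [toRatFunc_ofPoly, toRatFunc_ofPoly] at this
  exact IsFractionRing.injective _ _ this

theorem ringB_eq_adjoin (n : ℕ) : ringB k n = Algebra.adjoin k {xCoord k, yCoord k,
    (xCoord k - 1) / (xCoord k ^ n * yCoord k - 1)} := by
  set z := (xCoord k - 1) / (xCoord k ^ n * yCoord k - 1) with hz
  have hmem (f) : f ∈ ringB k n ↔ f ∈ Algebra.adjoin (MvPolynomial (Fin 2) k) {z} := Iff.rfl
  refine le_antisymm (fun f hf => ?_) (Algebra.adjoin_le ?_)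
  · rw [hmem] at hf
    induction hf using Algebra.adjoin_induction with
    | mem f hf => exact Algebra.subset_adjoin (by rw [hf]; simp)
    | add a b _ _ iha ihb => exact add_mem iha ihb
    | mul a b _ _ iha ihb => exact mul_mem iha ihb
    | algebraMap p =>
      induction p using MvPolynomial.induction_on with
      | C a => exact Subalgebra.algebraMap_mem _ a
      | add p q hp hq => rw [map_add]; exact add_mem hp hq
      | mul_X p i hp =>
        rw [map_mul]
        refine mul_mem hp (Algebra.subset_adjoin ?_)
        fin_cases i
        · exact Or.inl rfl
        · exact Or.inr (Or.inl rfl)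
  · rintro f (rfl | rfl | rfl)
    · exact (hmem _).2 (Subalgebra.algebraMap_mem _ _)
    · exact (hmem _).2 (Subalgebra.algebraMap_mem _ _)
    · exact (hmem _).2 (Algebra.subset_adjoin rfl)

/-- The ring `ringB k n` in Laurent coordinates. -/
theorem nonempty_ringB_algEquiv_surface {n : ℕ} (hn : 0 < n) :
    Nonempty (ringB k n ≃ₐ[k] surface k n) := by
  -- Both rings are compared as subalgebras of the fraction field of the Laurent ring, where their
  -- generators coincide.
  let i : Laurent k →ₐ[k] FractionRing (Laurent k) := IsScalarTower.toAlgHom k _ _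
  have hi : Function.Injective i := IsFractionRing.injective (Laurent k) _
  have hinj : Function.Injective (i.comp (ofPoly k n)) := hi.comp (ofPoly_injective k hn)
  let e : FractionRing (MvPolynomial (Fin 2) k) →ₐ[k] FractionRing (Laurent k) :=
    IsFractionRing.liftAlgHom hinj
  have he (p : MvPolynomial (Fin 2) k) : e (algebraMap _ _ p) = i (ofPoly k n p) :=
    IsFractionRing.lift_algebraMap hinj p
  have hex : e (xCoord k) = i (X k) := by rw [xCoord, he, ofPoly_X_zero]
  have hey : e (yCoord k) = i (Y k n) := by rw [yCoord, he, ofPoly_X_one]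
  have hez : e ((xCoord k - 1) / (xCoord k ^ n * yCoord k - 1)) = i (Z k) := by
    have hU : i (U k) ≠ 0 := by
      rw [Ne, map_eq_zero_iff i hi]; exact U_ne_zero k
    rw [map_div₀, map_sub, map_sub, map_mul, map_pow, hex, hey, map_one, ← map_pow, ← map_mul,
      X_pow_mul_Y, map_add, map_one, add_sub_cancel_right, div_eq_iff hU, ← map_mul,
      mul_comm (Z k), U_mul_Z, map_sub, map_one]
  have key : (ringB k n).map e = (surface k n).map i := by
    rw [ringB_eq_adjoin, surface, AlgHom.map_adjoin, AlgHom.map_adjoin]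
    simp only [Set.image_insert_eq, Set.image_singleton, hex, hey, hez]
  exact ⟨((ringB k n).equivMapOfInjective e e.toRingHom.injective).trans
    ((Subalgebra.equivOfEq _ _ key).trans ((surface k n).equivMapOfInjective i hi).symm)⟩

variable {k}

/-- Only `Z` has a denominator over `k[x, y]`, namely `U`. Clearing it moves divisibility by `x`
into a polynomial ring, where `x` is prime. -/
theorem exists_ofPoly_eq_mul_U_pow {n : ℕ} {f : Laurent k} (hf : f ∈ surface k n) :
    ∃ (N : ℕ) (p : MvPolynomial (Fin 2) k), ofPoly k n p = f * U k ^ N := by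
  have hU : ofPoly k n (MvPolynomial.X 0 ^ n * MvPolynomial.X 1 - 1) = U k := by
    rw [map_sub, map_mul, map_pow, ofPoly_X_zero, ofPoly_X_one, map_one, X_pow_mul_Y,
      add_sub_cancel_right]
  induction hf using Algebra.adjoin_induction with
  | mem f hf =>
    rcases hf with rfl | rfl | rfl
    · exact ⟨0, .X 0, by simp [ofPoly_X_zero]⟩
    · exact ⟨0, .X 1, by simp [ofPoly_X_one]⟩
    · exact ⟨1, .X 0 - 1, by
        rw [map_sub, map_one, ofPoly_X_zero, pow_one, mul_comm, U_mul_Z]⟩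
  | algebraMap r => exact ⟨0, .C r, by rw [pow_zero, mul_one]; exact (ofPoly k n).commutes r⟩
  | add f g _ _ ihf ihg =>
    obtain ⟨N, p, hp⟩ := ihf
    obtain ⟨M, q, hq⟩ := ihg
    refine ⟨N + M, p * (MvPolynomial.X 0 ^ n * MvPolynomial.X 1 - 1) ^ M +
      q * (MvPolynomial.X 0 ^ n * MvPolynomial.X 1 - 1) ^ N, ?_⟩
    rw [map_add, map_mul, map_mul, map_pow, map_pow, hU, hp, hq]
    ring
  | mul f g _ _ ihf ihg =>
    obtain ⟨N, p, hp⟩ := ihf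
    obtain ⟨M, q, hq⟩ := ihg
    exact ⟨N + M, p * q, by rw [map_mul, hp, hq]; ring⟩

theorem sub_one_dvd_sub_one {m n : ℕ} (hm : 0 < m) (hn : 0 < n)
    (φ : surface k m ≃ₐ[k] surface k n) : m - 1 ∣ n - 1 := by
  obtain ⟨c, hcu, r, hr, h⟩ := exists_isUnit_mul_map_xS_pow hm hn φ
  obtain ⟨d, hd⟩ := hcu.exists_right_inv
  set x : MvPolynomial (Fin 2) k := .X 0 with hx
  set u : MvPolynomial (Fin 2) k := x ^ n * .X 1 - 1 with hu
  have hxL : ofPoly k n x = X k := ofPoly_X_zero k n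
  have huL : ofPoly k n u = U k := by
    rw [hu, map_sub, map_mul, map_pow, hxL, ofPoly_X_one, map_one, X_pow_mul_Y,
      add_sub_cancel_right]
  obtain ⟨N, p, hp⟩ := exists_ofPoly_eq_mul_U_pow c.2
  obtain ⟨M, q, hq⟩ := exists_ofPoly_eq_mul_U_pow d.2
  obtain ⟨P, a, ha⟩ := exists_ofPoly_eq_mul_U_pow (φ (xS k m)).2
  have hdL : (c : Laurent k) * d = 1 := congrArg Subtype.val hd
  have hL : (c : Laurent k) * (φ (xS k m) : Laurent k) ^ (m - 1) =
      ofPoly k n (.C r) * X k ^ (n - 1) := by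
    rw [show ofPoly k n (.C r) = algebraMap k _ r from (ofPoly k n).commutes r]
    exact congrArg Subtype.val h
  -- Here `c * d = 1` with denominators cleared; as `x` does not divide `u`, it does not divide the
  -- numerator `p` of the unit `c`.
  have e1 : p * q = u ^ (N + M) := by
    apply ofPoly_injective k hn
    rw [map_mul, hp, hq, map_pow, huL]
    linear_combination U k ^ (N + M) * hdL
  have e2 : p * a ^ (m - 1) = .C r * u ^ (N + P * (m - 1)) * x ^ (n - 1) := by
    apply ofPoly_injective k hn
    simp only [map_mul, map_pow, hp, ha, huL, hxL]
    rw [mul_pow, ← pow_mul, pow_add]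
    linear_combination U k ^ N * U k ^ (P * (m - 1)) * hL
  have hprime : Prime x := MvPolynomial.X_prime
  have hxu : ¬ x ∣ u := by
    rintro ⟨w, hw⟩
    have := congrArg (MvPolynomial.eval (fun _ => (0 : k))) hw
    simp [hu, hx, hn.ne'] at this
  have hxp : ¬ x ∣ p := fun hdvd => by
    have : x ∣ u ^ (N + M) := e1 ▸ hdvd.mul_right q
    exact hxu (hprime.dvd_of_dvd_pow this)
  have hxr : ¬ x ∣ MvPolynomial.C r := by
    rintro ⟨w, hw⟩
    have := congrArg (MvPolynomial.eval (fun _ => (0 : k))) hw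
    simp [hx, hr] at this
  have h0 (b : MvPolynomial (Fin 2) k) (hb : ¬ x ∣ b) : emultiplicity x b = 0 :=
    emultiplicity_eq_zero.2 hb
  -- All factors other than `a ^ (m - 1)` and `x ^ (n - 1)` have multiplicity zero.
  have hfin := congrArg (emultiplicity x) e2
  rw [emultiplicity_mul hprime, emultiplicity_mul hprime, emultiplicity_mul hprime,
    emultiplicity_pow hprime, emultiplicity_pow hprime, h0 p hxp, h0 u hxu, h0 _ hxr,
    emultiplicity_pow_self hprime.ne_zero hprime.not_isUnit] at hfin
  simp only [zero_add, mul_zero] at hfin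
  generalize emultiplicity x a = e at hfin
  induction e with
  -- Infinite multiplicity is compatible with the finite right side only if `m - 1 = 0`, and then `n
  -- - 1 = 0`.
  | top =>
    rcases Nat.eq_zero_or_pos (m - 1) with h1 | h1
    · rw [h1, Nat.cast_zero, zero_mul] at hfin
      rw [show n - 1 = 0 by exact_mod_cast hfin.symm]
      exact dvd_zero _
    · rw [ENat.mul_top (by exact_mod_cast h1.ne')] at hfin
      exact absurd hfin (ENat.top_ne_natCast _)
  | coe e => exact ⟨e, by exact_mod_cast hfin.symm⟩

end LaurentSurface

theorem theorem4p1 (k : Type*) [Field k] (m n : ℕ) (hm : 0 < m) (hn : 0 < n)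
    (h : Nonempty (ringB k m ≃ₐ[k] ringB k n)) : m = n := by
  obtain ⟨h⟩ := h
  obtain ⟨α⟩ := LaurentSurface.nonempty_ringB_algEquiv_surface k hm
  obtain ⟨β⟩ := LaurentSurface.nonempty_ringB_algEquiv_surface k hn
  have φ := (α.symm.trans h).trans β
  have := Nat.dvd_antisymm (LaurentSurface.sub_one_dvd_sub_one hm hn φ)
    (LaurentSurface.sub_one_dvd_sub_one hn hm φ.symm)
  omega
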